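/- For $N\ge 1$ and a function $f:(S^1)^N\to\mathbb{C}$ put $$\mathbb{E}_{\mathrm{ACUE}(N)}\big[f(e(\vartheta_1),\dots,e(\vartheta_N))\big]=\frac{1}{N!\,(2N)^N}\sum_{t_1,\dots,t_N} f(e(t_1),\dots,e(t_N))\prod_{1\le j<k\le N}|e(t_j)-e(t_k)|^2,$$ where $e(t)=e^{2\pi i t}$ and each $t_i$ runs over $\{0,\tfrac1{2N},\dots,\tfrac{2N-1}{2N}\}$, and let $g=\mathrm{diag}(e(\vartheta_1),\dots,e(\vartheta_N))$. **Theorem.** Let $N$ and $J$ be positive integers, let $v_1,\dots,v_J$ be complex numbers, and let $u_1,\dots,u_J$ be complex numbers which are not $2N$-th roots of unity, with $v_i\neq u_j$ for all $i,j$. If $u_1,\dots,u_J$ are distinct and $v_1,\dots,v_J$ are distinct, then $\det\big(\frac{1}{u_i-v_j}\big)\ne 0$ and $$\mathbb{E}_{\mathrm{ACUE}(N)}\Bigg[\frac{\prod_{j=1}^J\det(1+v_jg)}{\prod_{j=1}^J\det(1+u_jg)}\Bigg]=\frac{1}{\det\Big(\frac{1}{u_i-v_j}\Big)}\det\left(\frac{1}{u_i-v_j}\,\mathbb{E}_{\mathrm{ACUE}(N)}\Big[\frac{\det(1+v_jg)}{\det(1+u_ig)}\Big]\right),$$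 where the determinants on the right-hand side are of $J\times J$ matrices, over the indices $1\le i,j\le J$. If some of the $u_i$ coincide or some of the $v_j$ coincide, the identity holds with the right-hand side (formally $0/0$) understood by continuity: in all cases the left-hand side at $(u,v)$ is the limit of the right-hand side at $(u',v')$ as $(u',v')\to(u,v)$ through pairs in which the $u'_i$ are distinct and the $v'_j$ are distinct. -/

import Mathlib

open Filter Topology

noncomputable section

namespace ACUE

/-- `e(t) = exp(2πit)`, as a point of the unit circle. -/
def e (t : ℝ) : Circle := Circle.exp (2 * Real.pi * t)

/-- The Vandermonde product `∏_{j < k} (x_j - x_k)`. -/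
def vandermonde {N : ℕ} (x : Fin N → ℂ) : ℂ :=
  ∏ j : Fin N, ∏ k ∈ Finset.Ioi j, (x j - x k)

/-- The points `(e(t_1), …, e(t_N))` with `t_i = m_i / (2N)`, where `m_i ∈ {0, …, 2N - 1}`. -/
def gridPoint (N : ℕ) (m : Fin N → Fin (2 * N)) : Fin N → Circle :=
  fun i => e (((m i : ℕ) : ℝ) / (2 * (N : ℝ)))

/-- The expectation of `f(e(ϑ_1), …, e(ϑ_N))` over the Alternative Circular Unitary Ensemble:
the joint density with respect to counting on `N`-tuples of `2N`-th roots of unity is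
`|Δ|² / (N! (2N)^N)`. -/
def expectation (N : ℕ) (f : (Fin N → Circle) → ℂ) : ℂ :=
  1 / (N.factorial : ℂ) * (1 / (2 * (N : ℂ)) ^ N) *
    ∑ m : Fin N → Fin (2 * N), f (gridPoint N m) *
      ((‖vandermonde (fun i => (gridPoint N m i : ℂ))‖ ^ 2 : ℝ) : ℂ)

/-- The matrix `g = diag(e(ϑ_1), …, e(ϑ_N))` of a configuration. -/
def diagMatrix {N : ℕ} (z : Fin N → Circle) : Matrix (Fin N) (Fin N) ℂ :=
  Matrix.diagonal (fun i => (z i : ℂ))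

/-- The average of `∏_j det(1 + v_j g) / ∏_j det(1 + u_j g)`. -/
def ratioAverage (N : ℕ) {J : ℕ} (u v : Fin J → ℂ) : ℂ :=
  expectation N fun z =>
    (∏ j, (1 + v j • diagMatrix z).det) / (∏ j, (1 + u j • diagMatrix z).det)

/-- The average of a single ratio `det(1 + v g) / det(1 + u g)`. -/
def singleRatioAverage (N : ℕ) (u v : ℂ) : ℂ :=
  expectation N fun z => (1 + v • diagMatrix z).det / (1 + u • diagMatrix z).det

/-- The `J × J` Cauchy determinant `det(1 / (u_i - v_j))`. -/
def cauchyDet {J : ℕ} (u v : Fin J → ℂ) : ℂ :=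
  (Matrix.of fun i j : Fin J => 1 / (u i - v j)).det

/-- The Cauchy-normalised determinant
`det(E[det(1 + v_j g) / det(1 + u_i g)] / (u_i - v_j)) / det(1 / (u_i - v_j))`. -/
def ratioDeterminant (N : ℕ) {J : ℕ} (u v : Fin J → ℂ) : ℂ :=
  1 / cauchyDet u v *
    (Matrix.of fun i j : Fin J => 1 / (u i - v j) * singleRatioAverage N (u i) (v j)).det

end ACUE

end

noncomputable section

namespace ACUE

open Matrix

/-! Put `w_k = -1/z_k`. The ratio of determinants becomes `∏ (v_j - w_k) / ∏ (u_j - w_k)`. Times the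
Cauchy determinant and the Vandermonde of `w`, it is a single mixed Cauchy–Vandermonde determinant
(`det_cauchy_vandermonde`). The other Vandermonde factor of the density is kept apart, and
Andréief's identity sums the product over the grid. Discrete orthogonality (`sum_gridNode_pow`)
makes the monomial block of the resulting determinant the identity, so its Schur complement is a `J
× J` determinant of a kernel in `(u_i, v_j)`. The case `J = 1` identifies this kernel with the
single-ratio average. Coincident points follow from continuity of the left-hand side. -/

/-- Andréief's identity for a determinant with additional columns `B` that are not summed over. -/
theorem sum_det_mul_det {ι n κ R : Type*} [Fintype ι] [DecidableEq ι] [Fintype n] [DecidableEq n]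
    [Fintype κ] [CommRing R] (B : ι ⊕ n → ι → R) (b : ι ⊕ n → κ → R) (φ : n → κ → R) :
    ∑ x : n → κ, (of fun r => Sum.elim (B r) fun k => b r (x k)).det *
        (of fun m k => φ m (x k)).det =
      ((Fintype.card n).factorial : R) *
        (of fun r => Sum.elim (B r) fun m => ∑ y, b r y * φ m y).det := by
  classical
  set G : Matrix (ι ⊕ n) (ι ⊕ n) R :=
    of fun r => Sum.elim (B r) fun m => ∑ y, b r y * φ m y with hG
  -- Each `x k` enters only column `k`, so the sum acts column by column and yields `G` with its
  -- `n`-columns permuted by `σ`.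
  have key (σ : Equiv.Perm n) :
      ∑ x : n → κ, (of fun r => Sum.elim (B r) fun k => b r (x k)).det * ∏ k, φ (σ k) (x k) =
        ((Equiv.Perm.sign σ : ℤ) : R) * G.det := by
    have hperm := det_permute' (Equiv.sumCongr (Equiv.refl ι) σ) G
    have hsign : Equiv.Perm.sign (Equiv.sumCongr (Equiv.refl ι) σ) = Equiv.Perm.sign σ := by
      simp
    rw [hsign] at hperm
    rw [← hperm]
    simp only [det_apply', Finset.sum_mul]
    rw [Finset.sum_comm]
    refine Finset.sum_congr rfl fun τ _ => ?_
    simp only [Fintype.prod_sum_type, of_apply, Sum.elim_inl, Sum.elim_inr, submatrix_apply, id,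
      Equiv.sumCongr_apply, Sum.map_inl, Sum.map_inr, hG, Equiv.refl_apply]
    rw [Finset.prod_univ_sum]
    simp only [Fintype.piFinset_univ, Finset.mul_sum, Finset.prod_mul_distrib]
    exact Finset.sum_congr rfl fun x _ => by ring
  have hdet (x : n → κ) : (of fun m k => φ m (x k)).det =
      ∑ σ : Equiv.Perm n, ((Equiv.Perm.sign σ : ℤ) : R) * ∏ k, φ (σ k) (x k) := by
    simp [det_apply']
  simp only [hdet, Finset.mul_sum]
  rw [Finset.sum_comm]
  calc _ = ∑ σ : Equiv.Perm n, ((Equiv.Perm.sign σ : ℤ) : R) *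
        (((Equiv.Perm.sign σ : ℤ) : R) * G.det) := by
        refine Finset.sum_congr rfl fun σ _ => ?_
        rw [← key, Finset.mul_sum]
        exact Finset.sum_congr rfl fun x _ => by ring
    _ = ∑ σ : Equiv.Perm n, G.det := by
        refine Finset.sum_congr rfl fun σ _ => ?_
        rw [← mul_assoc, ← Int.cast_mul, ← Units.val_mul, Int.units_mul_self]
        simp
    _ = _ := by simp [Fintype.card_perm]

/-- The polynomial interpolating `1 / (u - x)` at the nodes `w`, with its interpolation error. -/
theorem exists_interpolation {K : Type*} [Field K] {N : ℕ} (w : Fin N → K) (u : K)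
    (hu : ∀ k, u ≠ w k) :
    ∃ a : Fin N → K, ∀ x, (u - x) * ∑ m, a m * x ^ (m : ℕ) = 1 - ∏ k, (x - w k) / (u - w k) := by
  open Polynomial in
  set q : K[X] := C (∏ k, (u - w k)⁻¹) * ∏ k, (X - C (w k)) - 1 with hq
  have hev (x : K) : q.eval x = ∏ k, (x - w k) / (u - w k) - 1 := by
    simp [hq, eval_prod, div_eq_mul_inv, Finset.prod_mul_distrib, mul_comm]
  have hroot : q.IsRoot u := by
    rw [IsRoot, hev, Finset.prod_eq_one fun k _ => div_self (sub_ne_zero.2 (hu k)), sub_self]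
  have hqdeg : q.natDegree ≤ N := by
    refine (natDegree_sub_le _ _).trans (max_le ((natDegree_C_mul_le _ _).trans ?_) (by simp))
    rw [natDegree_finsetProd_X_sub_C_eq_card]
    simp
  -- For `N = 0` the bound `p.natDegree < N` is impossible, but both sides of the identity are zero.
  rcases Nat.eq_zero_or_pos N with rfl | hN
  · exact ⟨0, fun x => by simp⟩
  obtain ⟨p, hp⟩ := dvd_iff_isRoot.2 hroot
  have hpdeg : p.natDegree < N := by
    rcases eq_or_ne p 0 with rfl | hp0
    · simpa using hN
    · have := congrArg natDegree hp
      rw [natDegree_mul (X_sub_C_ne_zero u) hp0, natDegree_X_sub_C] at this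
      omega
  refine ⟨fun m => p.coeff m, fun x => ?_⟩
  rw [Fin.sum_univ_eq_sum_range fun m => p.coeff m * x ^ m, ← eval_eq_sum_range' hpdeg]
  have := congrArg (eval x) hp
  rw [hev] at this
  simp only [eval_mul, eval_sub, eval_X, eval_C] at this
  linear_combination this

/-- The mixed Cauchy–Vandermonde determinant, with the pure Cauchy determinant split off. -/
theorem det_cauchy_vandermonde {J N : ℕ} (u v : Fin J → ℂ) (w : Fin N → ℂ)
    (huv : ∀ i j, u i ≠ v j) (huw : ∀ i k, u i ≠ w k) :
    (fromBlocks (of fun i j => 1 / (u i - v j)) (of fun i k => 1 / (u i - w k))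
        (of fun (m : Fin N) j => v j ^ (m : ℕ)) (of fun (m k : Fin N) => w k ^ (m : ℕ))).det =
      cauchyDet u v * (∏ j, ∏ k, (v j - w k)) / (∏ i, ∏ k, (u i - w k)) *
        (Matrix.vandermonde w).det := by
  choose a ha using fun i => exists_interpolation w (u i) (huw i)
  set A : Matrix (Fin J) (Fin N) ℂ := of a with hA
  -- Row operation: subtracting the interpolant of `1 / (u i - x)` from row `i` clears the block at
  -- the nodes `w` and leaves the interpolation error in the Cauchy block.
  set P : Matrix (Fin J ⊕ Fin N) (Fin J ⊕ Fin N) ℂ := fromBlocks 1 (-A) 0 1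
  have hP : P.det = 1 := by simp [P]
  have hmul : P * fromBlocks (of fun i j => 1 / (u i - v j)) (of fun i k => 1 / (u i - w k))
        (of fun (m : Fin N) j => v j ^ (m : ℕ)) (of fun (m k : Fin N) => w k ^ (m : ℕ)) =
      fromBlocks (of fun i j => (∏ k, (u i - w k))⁻¹ *
          ((∏ k, (v j - w k)) * (1 / (u i - v j)))) 0
        (of fun (m : Fin N) j => v j ^ (m : ℕ)) (of fun (m k : Fin N) => w k ^ (m : ℕ)) := by
    rw [fromBlocks_multiply]
    congr 1
    · ext i j
      have h0 : u i - v j ≠ 0 := sub_ne_zero.2 (huv i j)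
      have h := ha i (v j)
      have hsum : ((-A) * of fun (m : Fin N) j => v j ^ (m : ℕ)) i j =
          -∑ m, a i m * v j ^ (m : ℕ) := by
        simp [mul_apply, hA]
      rw [Matrix.one_mul, Matrix.add_apply, hsum, of_apply, of_apply]
      rw [Finset.prod_div_distrib] at h
      rw [mul_comm] at h
      rw [eq_div_of_mul_eq h0 h]
      field_simp
      ring
    · ext i k
      have h0 : u i - w k ≠ 0 := sub_ne_zero.2 (huw i k)
      have h := ha i (w k)
      rw [Finset.prod_eq_zero (Finset.mem_univ k) (by simp), sub_zero] at h
      have hsum : ((-A) * of fun (m k : Fin N) => w k ^ (m : ℕ)) i k =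
          -∑ m, a i m * w k ^ (m : ℕ) := by
        simp [mul_apply, hA]
      rw [Matrix.one_mul, Matrix.add_apply, hsum, of_apply, Matrix.zero_apply, eq_one_div_of_mul_eq_one_right h]
      ring
    · simp
    · simp
  have hV : (of fun (m k : Fin N) => w k ^ (m : ℕ)).det = (Matrix.vandermonde w).det := by
    rw [← det_transpose]
    rfl
  have hdet := congrArg det hmul
  rw [det_mul, hP, one_mul, det_fromBlocks_zero₁₂, hV] at hdet
  rw [hdet]
  congr 1
  have h1 := det_mul_column (fun i => (∏ k, (u i - w k))⁻¹)
    (of fun i j => (∏ k, (v j - w k)) * (1 / (u i - v j)))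
  have h2 := det_mul_row (fun j => ∏ k, (v j - w k)) (of fun i j => 1 / (u i - v j))
  simp only [of_apply] at h1 h2
  rw [h1, h2, Finset.prod_inv_distrib, cauchyDet]
  ring

/-- A kernel vector `x` makes the numerator of `∑ x_j / (X - v_j)`, of degree less than `J`, vanish
at the `J` points `u_i`. It is therefore zero, and its value at `v_j` forces `x_j = 0`. -/
theorem cauchyDet_ne_zero {J : ℕ} {u v : Fin J → ℂ} (huv : ∀ i j, u i ≠ v j)
    (hu : Function.Injective u) (hv : Function.Injective v) : cauchyDet u v ≠ 0 := by
  rw [cauchyDet, Ne, ← exists_mulVec_eq_zero_iff]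
  rintro ⟨x, hx, hx0⟩
  open Polynomial in
  set P : ℂ[X] := ∑ j, C (x j) * ∏ k ∈ Finset.univ.erase j, (X - C (v k)) with hP
  have hdeg : P.natDegree < J := by
    have hJ : 0 < J := by
      obtain ⟨j, _⟩ := Function.ne_iff.1 hx
      exact j.pos
    refine lt_of_le_of_lt (b := J - 1) (natDegree_sum_le_of_forall_le _ _ fun j _ => ?_) (by omega)
    refine (natDegree_C_mul_le _ _).trans ?_
    rw [natDegree_finsetProd_X_sub_C_eq_card]
    simp
  have hPu (i : Fin J) : P.eval (u i) = 0 := by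
    have h := congrFun hx0 i
    simp only [mulVec, dotProduct, of_apply, Pi.zero_apply] at h
    have : P.eval (u i) = (∏ k, (u i - v k)) * ∑ j, 1 / (u i - v j) * x j := by
      simp only [hP, eval_finsetSum, eval_mul, eval_C, eval_prod, eval_sub, eval_X, Finset.mul_sum]
      refine Finset.sum_congr rfl fun j _ => ?_
      rw [← Finset.mul_prod_erase _ _ (Finset.mem_univ j)]
      have h0 := sub_ne_zero.2 (huv i j)
      field_simp
    rw [this, h, mul_zero]
  have hP0 : P = 0 := eq_zero_of_natDegree_lt_card_of_eval_eq_zero P hu hPu (by simpa using hdeg)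
  refine hx (funext fun j => ?_)
  have h := congrArg (eval (v j)) hP0
  simp only [hP, eval_finsetSum, eval_mul, eval_C, eval_prod, eval_sub, eval_X, eval_zero] at h
  rw [Finset.sum_eq_single j (fun i _ hij => ?_) (by simp)] at h
  · refine (mul_eq_zero.1 h).resolve_right (Finset.prod_ne_zero_iff.2 fun k hk => ?_)
    exact sub_ne_zero.2 fun h => (Finset.ne_of_mem_erase hk) (hv h).symm
  · rw [Finset.prod_eq_zero (Finset.mem_erase.2 ⟨hij.symm, Finset.mem_univ j⟩) (sub_self _),
      mul_zero]

/-- The `2N`-th root of unity `e(x / (2N))`. -/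
def gridRoot (N : ℕ) (x : Fin (2 * N)) : ℂ :=
  (e (((x : ℕ) : ℝ) / (2 * (N : ℝ))) : ℂ)

theorem coe_gridPoint (N : ℕ) (m : Fin N → Fin (2 * N)) (i : Fin N) :
    (gridPoint N m i : ℂ) = gridRoot N (m i) := rfl

theorem gridRoot_ne_zero (N : ℕ) (x : Fin (2 * N)) : gridRoot N x ≠ 0 := Circle.coe_ne_zero _

theorem gridRoot_eq_pow (N : ℕ) (x : Fin (2 * N)) :
    gridRoot N x = Complex.exp (2 * Real.pi * Complex.I / ((2 * N : ℕ) : ℂ)) ^ (x : ℕ) := by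
  rw [gridRoot, e, Circle.coe_exp, ← Complex.exp_nat_mul]
  congr 1
  push_cast
  ring

theorem isPrimitiveRoot_grid {N : ℕ} (hN : 1 ≤ N) :
    IsPrimitiveRoot (Complex.exp (2 * Real.pi * Complex.I / ((2 * N : ℕ) : ℂ))) (2 * N) :=
  Complex.isPrimitiveRoot_exp _ (by omega)

theorem gridRoot_pow (N : ℕ) (x : Fin (2 * N)) : gridRoot N x ^ (2 * N) = 1 := by
  have hN : 1 ≤ N := by have := x.pos; omega
  rw [gridRoot_eq_pow, pow_right_comm, (isPrimitiveRoot_grid hN).pow_eq_one, one_pow]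

/-- The zero `-1 / z` of `u ↦ 1 + u z`, at a grid point `z`. -/
def gridNode (N : ℕ) (x : Fin (2 * N)) : ℂ := -(gridRoot N x)⁻¹

theorem gridNode_pow (N : ℕ) (x : Fin (2 * N)) : gridNode N x ^ (2 * N) = 1 := by
  rw [gridNode, (even_two_mul N).neg_pow, inv_pow, gridRoot_pow, inv_one]

theorem ne_gridNode {N : ℕ} {u : ℂ} (hu : u ^ (2 * N) ≠ 1) (x : Fin (2 * N)) :
    u ≠ gridNode N x := fun h => hu (h ▸ gridNode_pow N x)

theorem one_add_mul_gridRoot (N : ℕ) (u : ℂ) (x : Fin (2 * N)) :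
    1 + u * gridRoot N x = gridRoot N x * (u - gridNode N x) := by
  have := gridRoot_ne_zero N x
  rw [gridNode]
  field_simp
  ring

theorem conj_gridRoot (N : ℕ) (x : Fin (2 * N)) :
    (starRingEnd ℂ) (gridRoot N x) = -gridNode N x := by
  rw [gridNode, neg_neg, gridRoot, ← Circle.coe_inv_eq_conj, Circle.coe_inv]

/-- Discrete orthogonality of the monomials of degree less than `N` on the nodes. -/
theorem sum_gridNode_pow {N : ℕ} (hN : 1 ≤ N) (l m : Fin N) :
    ∑ x, gridNode N x ^ (l : ℕ) * (1 / (2 * (N : ℂ)) * (-gridRoot N x) ^ (m : ℕ)) =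
      (1 : Matrix (Fin N) (Fin N) ℂ) l m := by
  have hN0 : (N : ℂ) ≠ 0 := by exact_mod_cast (by omega : N ≠ 0)
  have hζ := isPrimitiveRoot_grid hN
  set ζ := Complex.exp (2 * Real.pi * Complex.I / ((2 * N : ℕ) : ℂ))
  have hζ0 : ζ ≠ 0 := Complex.exp_ne_zero _
  have hterm (x : Fin (2 * N)) :
      gridNode N x ^ (l : ℕ) * (1 / (2 * (N : ℂ)) * (-gridRoot N x) ^ (m : ℕ)) =
        (-1) ^ (l + m : ℕ) * (1 / (2 * (N : ℂ))) * (ζ ^ (m : ℕ) / ζ ^ (l : ℕ)) ^ (x : ℕ) := by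
    rw [gridNode, neg_pow (gridRoot N x)⁻¹, neg_pow (gridRoot N x), gridRoot_eq_pow, div_pow,
      inv_pow, ← pow_mul, ← pow_mul, ← pow_mul, ← pow_mul, mul_comm (x : ℕ) l, mul_comm (x : ℕ) m,
      pow_add]
    ring
  simp only [hterm]
  rw [← Finset.mul_sum, Fin.sum_univ_eq_sum_range fun k => (ζ ^ (m : ℕ) / ζ ^ (l : ℕ)) ^ k]
  rcases eq_or_ne l m with rfl | hlm
  · rw [div_self (pow_ne_zero _ hζ0), one_apply_eq, ← two_mul, (even_two_mul _).neg_pow]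
    simp
    field_simp
  -- Exponents below `N` are distinct mod `2N`, so the geometric sum has a nontrivial ratio.
  · have hr : ζ ^ (m : ℕ) / ζ ^ (l : ℕ) ≠ 1 := by
      intro h
      rw [div_eq_one_iff_eq (pow_ne_zero _ hζ0)] at h
      exact hlm (Fin.ext (hζ.pow_inj (by omega) (by omega) h).symm)
    have hpow : (ζ ^ (m : ℕ) / ζ ^ (l : ℕ)) ^ (2 * N) = 1 := by
      rw [div_pow, pow_right_comm, pow_right_comm ζ (l : ℕ), hζ.pow_eq_one, one_pow, one_pow,
        div_one]
    rw [one_apply_ne hlm, geom_sum_eq hr, hpow, sub_self, zero_div, mul_zero]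

theorem det_vandermonde_neg_gridRoot (N : ℕ) (m : Fin N → Fin (2 * N)) :
    (Matrix.vandermonde fun k => -gridRoot N (m k)).det =
      ACUE.vandermonde fun k => (gridPoint N m k : ℂ) := by
  rw [det_vandermonde, ACUE.vandermonde]
  refine Finset.prod_congr rfl fun i _ => Finset.prod_congr rfl fun j _ => ?_
  rw [coe_gridPoint, coe_gridPoint]
  ring

theorem det_vandermonde_gridNode (N : ℕ) (m : Fin N → Fin (2 * N)) :
    (Matrix.vandermonde fun k => gridNode N (m k)).det =
      (starRingEnd ℂ) (ACUE.vandermonde fun k => (gridPoint N m k : ℂ)) := by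
  rw [det_vandermonde, ACUE.vandermonde, map_prod]
  refine Finset.prod_congr rfl fun i _ => ?_
  rw [map_prod]
  refine Finset.prod_congr rfl fun j _ => ?_
  rw [coe_gridPoint, coe_gridPoint, map_sub, conj_gridRoot, conj_gridRoot]
  ring

/-- On the unit circle conjugation is inversion, so one factor of the density can be written in the
nodes. -/
theorem norm_vandermonde_sq (N : ℕ) (m : Fin N → Fin (2 * N)) :
    ((‖ACUE.vandermonde (fun i => (gridPoint N m i : ℂ))‖ ^ 2 : ℝ) : ℂ) =
      (Matrix.vandermonde fun k => gridNode N (m k)).det *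
        (Matrix.vandermonde fun k => -gridRoot N (m k)).det := by
  rw [det_vandermonde_neg_gridRoot, det_vandermonde_gridNode, Complex.conj_mul']
  push_cast
  rfl

theorem det_one_add_smul (N : ℕ) (u : ℂ) (m : Fin N → Fin (2 * N)) :
    (1 + u • diagMatrix (gridPoint N m)).det =
      (∏ k, gridRoot N (m k)) * ∏ k, (u - gridNode N (m k)) := by
  rw [diagMatrix, ← diagonal_smul, ← diagonal_one, diagonal_add, det_diagonal,
    ← Finset.prod_mul_distrib]
  refine Finset.prod_congr rfl fun k _ => ?_
  rw [← one_add_mul_gridRoot, ← coe_gridPoint]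
  simp

theorem det_one_add_smul_ne_zero {N : ℕ} {u : ℂ} (hu : u ^ (2 * N) ≠ 1)
    (m : Fin N → Fin (2 * N)) : (1 + u • diagMatrix (gridPoint N m)).det ≠ 0 := by
  rw [det_one_add_smul]
  exact mul_ne_zero (Finset.prod_ne_zero_iff.2 fun k _ => gridRoot_ne_zero N _)
    (Finset.prod_ne_zero_iff.2 fun k _ => sub_ne_zero.2 (ne_gridNode hu _))

theorem prod_det_div_prod_det (N : ℕ) {J : ℕ} (u v : Fin J → ℂ) (m : Fin N → Fin (2 * N)) :
    (∏ j, (1 + v j • diagMatrix (gridPoint N m)).det) /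
        (∏ j, (1 + u j • diagMatrix (gridPoint N m)).det) =
      (∏ j, ∏ k, (v j - gridNode N (m k))) / ∏ j, ∏ k, (u j - gridNode N (m k)) := by
  simp only [det_one_add_smul, Finset.prod_mul_distrib, Finset.prod_const]
  -- Numerator and denominator both have `J` factors, so the powers of `∏ z_k` cancel.
  exact mul_div_mul_left _ _ (pow_ne_zero _
    (Finset.prod_ne_zero_iff.2 fun k _ => gridRoot_ne_zero N _))

/-- The kernel `1 / (u - v) * E[det(1 + v g) / det(1 + u g)]`. -/
def ratioKernel (N : ℕ) (u v : ℂ) : ℂ :=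
  1 / (u - v) - ∑ m : Fin N, (∑ x, 1 / (u - gridNode N x) *
    (1 / (2 * (N : ℂ)) * (-gridRoot N x) ^ (m : ℕ))) * v ^ (m : ℕ)

/-- Multiplying by the Cauchy determinant instead of dividing avoids any distinctness assumption. -/
theorem cauchyDet_mul_ratioAverage {N J : ℕ} (hN : 1 ≤ N) (u v : Fin J → ℂ)
    (hu : ∀ j, u j ^ (2 * N) ≠ 1) (huv : ∀ i j, u i ≠ v j) :
    cauchyDet u v * ratioAverage N u v = (of fun i j => ratioKernel N (u i) (v j)).det := by
  set φ : Fin N → Fin (2 * N) → ℂ := fun m x => 1 / (2 * (N : ℂ)) * (-gridRoot N x) ^ (m : ℕ)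
  set B : Fin J ⊕ Fin N → Fin J → ℂ :=
    Sum.elim (fun i j => 1 / (u i - v j)) (fun m j => v j ^ (m : ℕ))
  set b : Fin J ⊕ Fin N → Fin (2 * N) → ℂ :=
    Sum.elim (fun i x => 1 / (u i - gridNode N x)) (fun m x => gridNode N x ^ (m : ℕ))
  have hφ (x : Fin N → Fin (2 * N)) : (of fun m k => φ m (x k)).det =
      (1 / (2 * (N : ℂ))) ^ N * (Matrix.vandermonde fun k => -gridRoot N (x k)).det := by
    rw [← det_transpose (Matrix.vandermonde _)]
    have := det_smul (Matrix.vandermonde fun k => -gridRoot N (x k))ᵀ (1 / (2 * (N : ℂ)))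
    rw [Fintype.card_fin] at this
    rw [← this]
    rfl
  have hb (x : Fin N → Fin (2 * N)) :
      (of fun r => Sum.elim (B r) fun k => b r (x k)).det =
        cauchyDet u v * ((∏ j, ∏ k, (v j - gridNode N (x k))) /
          (∏ i, ∏ k, (u i - gridNode N (x k)))) *
          (Matrix.vandermonde fun k => gridNode N (x k)).det := by
    rw [← mul_div_assoc, ← det_cauchy_vandermonde u v _ huv fun i k => ne_gridNode (hu i) (x k)]
    congr 1
    ext (_ | _) (_ | _) <;> rfl
  have hblock : (of fun r => Sum.elim (B r) fun m => ∑ y, b r y * φ m y) =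
      fromBlocks (of fun i j => 1 / (u i - v j))
        (of fun i m => ∑ x, 1 / (u i - gridNode N x) * φ m x)
        (of fun (m : Fin N) j => v j ^ (m : ℕ)) 1 := by
    ext (_ | l) (_ | m)
    · rfl
    · rfl
    · rfl
    · exact sum_gridNode_pow hN l m
  have hand := sum_det_mul_det B b φ
  rw [hblock, det_fromBlocks_one₂₂, Fintype.card_fin] at hand
  have hker : (of fun i j => ratioKernel N (u i) (v j)) =
      (of fun i j => 1 / (u i - v j)) - (of fun i m => ∑ x, 1 / (u i - gridNode N x) * φ m x) *
        (of fun (m : Fin N) j => v j ^ (m : ℕ)) := by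
    ext i j
    simp only [of_apply, Matrix.sub_apply, mul_apply, ratioKernel, φ]
  have hfac : (N.factorial : ℂ) ≠ 0 := by exact_mod_cast N.factorial_ne_zero
  rw [hker, ← mul_right_inj' hfac, ← hand, ratioAverage, expectation]
  simp only [prod_det_div_prod_det, norm_vandermonde_sq, hb, hφ, Finset.mul_sum]
  refine Finset.sum_congr rfl fun x _ => ?_
  rw [_root_.one_div_pow]
  field_simp

theorem one_div_mul_singleRatioAverage {N : ℕ} (hN : 1 ≤ N) {u v : ℂ} (hu : u ^ (2 * N) ≠ 1)
    (huv : u ≠ v) : 1 / (u - v) * singleRatioAverage N u v = ratioKernel N u v := by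
  have h := cauchyDet_mul_ratioAverage (J := 1) hN (fun _ => u) (fun _ => v) (fun _ => hu)
    fun _ _ => huv
  simpa [cauchyDet, ratioAverage, singleRatioAverage] using h

theorem ratioAverage_eq_ratioDeterminant {N J : ℕ} (hN : 1 ≤ N) {u v : Fin J → ℂ}
    (hu : ∀ j, u j ^ (2 * N) ≠ 1) (huv : ∀ i j, u i ≠ v j) (hC : cauchyDet u v ≠ 0) :
    ratioAverage N u v = ratioDeterminant N u v := by
  have h : (of fun i j => 1 / (u i - v j) * singleRatioAverage N (u i) (v j)) =
      of fun i j => ratioKernel N (u i) (v j) := by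
    ext i j
    exact one_div_mul_singleRatioAverage hN (hu i) (huv i j)
  rw [ratioDeterminant, h, ← cauchyDet_mul_ratioAverage hN u v hu huv, one_div,
    inv_mul_cancel_left₀ hC]

theorem continuousAt_ratioAverage {N J : ℕ} {u v : Fin J → ℂ} (hu : ∀ j, u j ^ (2 * N) ≠ 1) :
    ContinuousAt (fun p : (Fin J → ℂ) × (Fin J → ℂ) => ratioAverage N p.1 p.2) (u, v) := by
  unfold ratioAverage expectation
  refine ContinuousAt.mul continuousAt_const (tendsto_finsetSum _ fun m _ => ?_)
  refine ContinuousAt.mul (ContinuousAt.div ?_ ?_ ?_) continuousAt_const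
  · exact Continuous.continuousAt (by fun_prop)
  · exact Continuous.continuousAt (by fun_prop)
  · exact Finset.prod_ne_zero_iff.2 fun j _ => det_one_add_smul_ne_zero (hu j) m

end ACUE

end

theorem theorem2p1 (N J : ℕ) (hN : 1 ≤ N) (hJ : 1 ≤ J) (u v : Fin J → ℂ)
    (hu : ∀ j, u j ^ (2 * N) ≠ 1) (huv : ∀ i j, v i ≠ u j) :
    (Function.Injective u → Function.Injective v →
      ACUE.cauchyDet u v ≠ 0 ∧ ACUE.ratioAverage N u v = ACUE.ratioDeterminant N u v) ∧
    Tendsto (fun p : (Fin J → ℂ) × (Fin J → ℂ) => ACUE.ratioDeterminant N p.1 p.2)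
      (𝓝[{p | Function.Injective p.1 ∧ Function.Injective p.2}] (u, v))
      (𝓝 (ACUE.ratioAverage N u v)) := by
  refine ⟨fun hui hvi => ?_, ?_⟩
  · have hC := ACUE.cauchyDet_ne_zero (fun i j => (huv j i).symm) hui hvi
    exact ⟨hC, ACUE.ratioAverage_eq_ratioDeterminant hN hu (fun i j => (huv j i).symm) hC⟩
  -- The conditions on `u` and `v` are open, so near `(u, v)` both sides agree at every pair of
  -- injective tuples.
  · refine ((ACUE.continuousAt_ratioAverage hu).tendsto.mono_left nhdsWithin_le_nhds).congr' ?_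
    have h1 : ∀ᶠ p : (Fin J → ℂ) × (Fin J → ℂ) in 𝓝 (u, v), ∀ j, p.1 j ^ (2 * N) ≠ 1 :=
      eventually_all.2 fun j => ContinuousAt.eventually_ne (by fun_prop) (hu j)
    have h2 : ∀ᶠ p : (Fin J → ℂ) × (Fin J → ℂ) in 𝓝 (u, v), ∀ i j, p.1 i - p.2 j ≠ 0 :=
      eventually_all.2 fun i => eventually_all.2 fun j =>
        ContinuousAt.eventually_ne (by fun_prop) (sub_ne_zero.2 (huv j i).symm)
    filter_upwards [nhdsWithin_le_nhds h1, nhdsWithin_le_nhds h2, self_mem_nhdsWithin]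
      with p hp1 hp2 hp3
    have hp (i j : Fin J) : p.1 i ≠ p.2 j := sub_ne_zero.1 (hp2 i j)
    exact ACUE.ratioAverage_eq_ratioDeterminant hN hp1 hp (ACUE.cauchyDet_ne_zero hp hp3.1 hp3.2)
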